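/- Let $d\ge 1$, let $\Omega\subset\mathbb{R}^d$ be non-empty, open and bounded (for instance a polytopal domain with $d\in\{1,2,3\}$), and let $V=H^1_0(\Omega)$ be the closure of $C_c^\infty(\Omega)$ in the $H^1$-norm. For $\lambda>0$ and $v\in V$ let $|||v|||_\lambda=(\lambda\|\nabla v\|_{L^2(\Omega)}^2+\|v\|_{L^2(\Omega)}^2)^{1/2}$, and let $C_P$ be the Poincaré constant of $\Omega$, i.e. the smallest constant such that $\|v\|_{L^2(\Omega)}^2\le C_P\|\nabla v\|_{L^2(\Omega)}^2$ for all $v\in V$. Let $f$ be a real-valued function of $(x,u)$ that is continuous on $\overline\Omega\times\mathbb{R}$ and differentiable in $u\in\mathbb{R}$ for every $x\in\Omega$, with $f(\cdot,0)\in L^2(\Omega)$. Let $\rho>0$ be such that the set $$\Lambda_f(\rho)=\{\lambda>0:\ \sigma_f(\lambda)<\rho+1/\lambda\},\qquad \sigma_f(\lambda)=\operatorname*{ess\,sup}_{x\in\Omega}\ \sup_{u\in\mathbb{R}}\left|\frac{\partial f}{\partial u}(x,u)+\frac1\lambda\right|,$$ is non-empty. Put $\mu_f=(\sup\Lambda_f(\rho))^{-1}$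 if $\sup\Lambda_f(\rho)<\infty$ and $\mu_f=0$ otherwise, and $$\kappa_f=\max\left\{\mu_f+\frac{\rho}{2}-\frac{1}{2C_P},\,0\right\}.$$ Suppose that the energy functional $$E(v)=\frac12\int_\Omega|\nabla v|^2\,dx-\int_\Omega\int_0^{v(x)}f(x,s)\,ds\,dx,\qquad v\in V,$$ is weakly coercive, i.e. $E(v)\to+\infty$ whenever $|||v|||_\lambda\to\infty$, for one (equivalently, every) $\lambda>0$. Let $\Delta t>0$ with $1/\Delta t>\kappa_f$, and let $u^0\in L^2(\Omega)$. Then there is exactly one sequence $(u^n)_{n\ge1}$ in $V$ such that, for all $n\ge0$, $$\int_\Omega\left(\Delta t\,\nabla u^{n+1}\cdot\nabla v+u^{n+1}v\right)dx=\int_\Omega\left(u^n+\Delta t\,f(x,u^n)\right)v\,dx\qquad\text{for all }v\in V,$$ and it has a subsequence that converges strongly in $H^1_0(\Omega)$ to a weak solution $u^\star\in V$ of $\Delta u+f(x,u)=0$ in $\Omega$, $u=0$ on $\partial\Omega$, that is, $$\int_\Omega\left(\nabla u^\star\cdot\nabla v-f(x,u^\star)\,v\right)dx=0\qquad\text{for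 all }v\in V.$$ -/

import Mathlib

open MeasureTheory Set Filter Topology
open scoped ContDiff ENNReal InnerProductSpace

noncomputable section

namespace Semilinear

/-- The Euclidean space `ℝ^d`. -/
abbrev Space (d : ℕ) : Type := EuclideanSpace ℝ (Fin d)

/-- The space `L²(Ω)`. -/
abbrev L2 {d : ℕ} (Ω : Set (Space d)) : Type := Lp ℝ 2 (volume.restrict Ω)

/-- The space `L²(Ω; ℝ^d)` of square integrable vector fields. -/
abbrev L2Vec {d : ℕ} (Ω : Set (Space d)) : Type := Lp (Space d) 2 (volume.restrict Ω)

/-- Pairs (function, vector field), with `‖(u, g)‖² = ‖u‖² + ‖g‖²`. A Sobolev function `u` is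
represented by the pair `(u, ∇u)`; the norm of that pair is the `H¹`-norm of `u`. -/
abbrev Pairs {d : ℕ} (Ω : Set (Space d)) : Type := WithLp 2 (L2 Ω × L2Vec Ω)

/-- Test functions: `φ ∈ C_c^∞(Ω)`. -/
structure IsTestFunction {d : ℕ} (Ω : Set (Space d)) (φ : Space d → ℝ) : Prop where
  contDiff : ContDiff ℝ ∞ φ
  hasCompactSupport : HasCompactSupport φ
  tsupport_subset : tsupport φ ⊆ Ω

/-- `g` is the weak gradient of `u` in `Ω`:
`∫_Ω u ∂_i φ = - ∫_Ω g_i φ` for all test functions `φ` and all `i`. -/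
def HasWeakGradient {d : ℕ} (Ω : Set (Space d)) (u : L2 Ω) (g : L2Vec Ω) : Prop :=
  ∀ φ : Space d → ℝ, IsTestFunction Ω φ → ∀ i : Fin d,
    ∫ x in Ω, u x * fderiv ℝ φ x (EuclideanSpace.single i 1) = - ∫ x in Ω, g x i * φ x

/-- The test functions, as the pairs `(φ, ∇φ)`. -/
def testSubmodule {d : ℕ} (Ω : Set (Space d)) : Submodule ℝ (Pairs Ω) where
  carrier := {w | ∃ φ : Space d → ℝ, IsTestFunction Ω φ ∧
    w.fst =ᵐ[volume.restrict Ω] φ ∧ w.snd =ᵐ[volume.restrict Ω] gradient φ}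
  zero_mem' := by
    refine ⟨0, ⟨contDiff_const, HasCompactSupport.zero, by simp [tsupport]⟩, ?_, ?_⟩
    · exact Lp.coeFn_zero _ _ _
    · refine (Lp.coeFn_zero (Space d) 2 (volume.restrict Ω)).trans ?_
      filter_upwards with x
      simp [gradient]
  add_mem' := by
    rintro a b ⟨φ, hφ, ha1, ha2⟩ ⟨ψ, hψ, hb1, hb2⟩
    refine ⟨φ + ψ, ⟨hφ.contDiff.add hψ.contDiff, hφ.hasCompactSupport.add hψ.hasCompactSupport,
      (tsupport_add φ ψ).trans (union_subset hφ.tsupport_subset hψ.tsupport_subset)⟩, ?_, ?_⟩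
    · filter_upwards [Lp.coeFn_add a.fst b.fst, ha1, hb1] with x h1 h2 h3
      simpa [h2, h3] using h1
    · filter_upwards [Lp.coeFn_add a.snd b.snd, ha2, hb2] with x h1 h2 h3
      have d1 : DifferentiableAt ℝ φ x := hφ.contDiff.differentiable (by simp) x
      have d2 : DifferentiableAt ℝ ψ x := hψ.contDiff.differentiable (by simp) x
      have : gradient (φ + ψ) x = gradient φ x + gradient ψ x := by
        simp [gradient, fderiv_add d1 d2]
      rw [this, ← h2, ← h3]
      simpa using h1
  smul_mem' := by
    rintro c a ⟨φ, hφ, ha1, ha2⟩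
    refine ⟨c • φ, ⟨hφ.contDiff.const_smul c, hφ.hasCompactSupport.smul_left,
      (tsupport_smul_subset_right (fun _ => c) φ).trans hφ.tsupport_subset⟩, ?_, ?_⟩
    · filter_upwards [Lp.coeFn_smul c a.fst, ha1] with x h1 h2
      simpa [h2] using h1
    · filter_upwards [Lp.coeFn_smul c a.snd, ha2] with x h1 h2
      have d1 : DifferentiableAt ℝ φ x := hφ.contDiff.differentiable (by simp) x
      have : gradient (c • φ) x = c • gradient φ x := by
        simp [gradient, fderiv_const_smul d1 c]
      rw [this, ← h2]
      simpa using h1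

/-- The space `V = H¹_0(Ω)`: the closure of `C_c^∞(Ω)` in the `H¹`-norm. Its elements are the
pairs `(u, ∇u)`; that the second component is the weak gradient of the first is
`hasWeakGradient_of_mem_H10`. -/
def H10 {d : ℕ} (Ω : Set (Space d)) : Submodule ℝ (Pairs Ω) :=
  (testSubmodule Ω).topologicalClosure

/-- The `L²`-function underlying an element of `H¹_0(Ω)`. -/
abbrev fn {d : ℕ} {Ω : Set (Space d)} (v : H10 Ω) : L2 Ω := (v : Pairs Ω).fst

/-- The weak gradient of an element of `H¹_0(Ω)`. -/
abbrev grad {d : ℕ} {Ω : Set (Space d)} (v : H10 Ω) : L2Vec Ω := (v : Pairs Ω).snd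

theorem hasWeakGradient_of_mem_H10 {d : ℕ} {Ω : Set (Space d)} {w : Pairs Ω} (hw : w ∈ H10 Ω) :
    HasWeakGradient Ω w.fst w.snd := by
  intro φ hφ i
  set e : Space d := EuclideanSpace.single i 1 with he
  have hdc : Continuous (fun x => fderiv ℝ φ x e) :=
    (hφ.contDiff.continuous_fderiv (by simp)).clm_apply continuous_const
  have hds : HasCompactSupport (fun x => fderiv ℝ φ x e) := hφ.hasCompactSupport.fderiv_apply ℝ e
  have m1 : MemLp (fun x => fderiv ℝ φ x e) 2 (volume.restrict Ω) :=
    hdc.memLp_of_hasCompactSupport hds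
  have hps : HasCompactSupport (fun x => φ x • e) := hφ.hasCompactSupport.smul_right
  have m2 : MemLp (fun x => φ x • e) 2 (volume.restrict Ω) :=
    (hφ.contDiff.continuous.smul continuous_const).memLp_of_hasCompactSupport hps
  have key : ∀ z : Pairs Ω,
      (∫ x in Ω, z.fst x * fderiv ℝ φ x e) + ∫ x in Ω, z.snd x i * φ x
        = ⟪m1.toLp _, z.fst⟫_ℝ + ⟪m2.toLp _, z.snd⟫_ℝ := by
    intro z
    rw [L2.inner_def, L2.inner_def]
    congr 1
    · refine integral_congr_ae ?_
      filter_upwards [m1.coeFn_toLp] with x hx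
      simp [hx]
    · refine integral_congr_ae ?_
      filter_upwards [m2.coeFn_toLp] with x hx
      rw [hx, he]
      simp [inner_smul_left, EuclideanSpace.inner_single_left, mul_comm]
  suffices h : ⟪m1.toLp _, w.fst⟫_ℝ + ⟪m2.toLp _, w.snd⟫_ℝ = 0 by
    have := key w
    linarith
  have hcl : IsClosed {z : Pairs Ω | ⟪m1.toLp _, z.fst⟫_ℝ + ⟪m2.toLp _, z.snd⟫_ℝ = 0} := by
    refine isClosed_eq ?_ continuous_const
    have c1 : Continuous (fun z : Pairs Ω => z.fst) := by fun_prop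
    have c2 : Continuous (fun z : Pairs Ω => z.snd) := by fun_prop
    exact (Continuous.inner (𝕜 := ℝ) continuous_const c1).add
      (Continuous.inner (𝕜 := ℝ) continuous_const c2)
  refine (closure_minimal ?_ hcl) hw
  rintro z ⟨ψ, hψ, h1, h2⟩
  change _ = _
  rw [← key z]
  have e1 : ∫ x in Ω, z.fst x * fderiv ℝ φ x e = ∫ x, ψ x * fderiv ℝ φ x e := by
    trans ∫ x in Ω, ψ x * fderiv ℝ φ x e
    · refine integral_congr_ae ?_
      filter_upwards [h1] with x hx
      rw [hx]
    · refine setIntegral_eq_integral_of_forall_compl_eq_zero fun x hx => ?_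
      have : ψ x = 0 := image_eq_zero_of_notMem_tsupport fun h => hx (hψ.tsupport_subset h)
      simp [this]
  have e2 : ∫ x in Ω, z.snd x i * φ x = ∫ x, fderiv ℝ ψ x e * φ x := by
    trans ∫ x in Ω, fderiv ℝ ψ x e * φ x
    · refine integral_congr_ae ?_
      filter_upwards [h2] with x hx
      have hg : ⟪gradient ψ x, e⟫_ℝ = fderiv ℝ ψ x e := by simp [gradient]
      rw [hx, ← hg, he, EuclideanSpace.inner_single_right]
      simp
    · refine setIntegral_eq_integral_of_forall_compl_eq_zero fun x hx => ?_
      have : φ x = 0 := image_eq_zero_of_notMem_tsupport fun h => hx (hφ.tsupport_subset h)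
      simp [this]
  have hψd : Continuous (fun x => fderiv ℝ ψ x e) :=
    (hψ.contDiff.continuous_fderiv (by simp)).clm_apply continuous_const
  rw [e1, e2, integral_mul_fderiv_eq_neg_fderiv_mul_of_integrable, neg_add_cancel]
  · exact (hψd.mul hφ.contDiff.continuous).integrable_of_hasCompactSupport
      hφ.hasCompactSupport.mul_left
  · exact (hψ.contDiff.continuous.mul hdc).integrable_of_hasCompactSupport
      hψ.hasCompactSupport.mul_right
  · exact (hψ.contDiff.continuous.mul hφ.contDiff.continuous).integrable_of_hasCompactSupport
      hψ.hasCompactSupport.mul_right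
  · exact fun x _ => hψ.contDiff.differentiable (by simp) x
  · exact fun x _ => hφ.contDiff.differentiable (by simp) x

/-- The norm `(λ ‖∇v‖² + ‖v‖²)^{1/2}` on `V`. -/
def lamNorm {d : ℕ} {Ω : Set (Space d)} (lam : ℝ) (v : H10 Ω) : ℝ :=
  Real.sqrt (lam * ‖grad v‖ ^ 2 + ‖fn v‖ ^ 2)

/-- The Poincaré constant of `Ω`: the smallest `C` (the infimum of all `C > 0`) with `‖v‖² ≤ C ‖∇v‖²` for all `v ∈ V`. -/
def poincareConst {d : ℕ} (Ω : Set (Space d)) : ℝ :=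
  sInf {C : ℝ | 0 < C ∧ ∀ v : H10 Ω, ‖fn v‖ ^ 2 ≤ C * ‖grad v‖ ^ 2}

/-- `F(x,t) = ∫_0^t f(x,s) ds`. -/
def primitive {d : ℕ} (f : Space d → ℝ → ℝ) (x : Space d) (t : ℝ) : ℝ :=
  ∫ s in (0 : ℝ)..t, f x s

/-- The energy `E(v) = ½ ∫_Ω |∇v|² - ∫_Ω F(x, v(x))`. -/
def energy {d : ℕ} {Ω : Set (Space d)} (f : Space d → ℝ → ℝ) (v : H10 Ω) : ℝ :=
  1 / 2 * (∫ x in Ω, ‖grad v x‖ ^ 2) - ∫ x in Ω, primitive f x (fn v x)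

/-- Weak coercivity: `E(v) → +∞` whenever `(λ ‖∇v‖² + ‖v‖²)^{1/2} → ∞`. These norms are
equivalent for all `λ > 0`, so that it does not matter for which `λ` this is required. -/
def IsWeaklyCoercive {d : ℕ} (Ω : Set (Space d)) (f : Space d → ℝ → ℝ) : Prop :=
  ∃ lam : ℝ, 0 < lam ∧ Tendsto (energy (Ω := Ω) f) (comap (lamNorm lam) atTop) atTop

/-- `⟨E'(u), v⟩ = ∫_Ω (∇u · ∇v - f(x,u) v)`. -/
def energyDeriv {d : ℕ} {Ω : Set (Space d)} (f : Space d → ℝ → ℝ) (u v : H10 Ω) : ℝ :=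
  ∫ x in Ω, (⟪grad u x, grad v x⟫_ℝ - f x (fn u x) * fn v x)

/-- `u ∈ V` is a weak solution of `Δu + f(x,u) = 0` in `Ω`, `u = 0` on `∂Ω`. -/
def IsWeakSolution {d : ℕ} {Ω : Set (Space d)} (f : Space d → ℝ → ℝ) (u : H10 Ω) : Prop :=
  ∀ v : H10 Ω, energyDeriv f u v = 0

/-- `σ_f(λ) = ess sup_{x ∈ Ω} sup_t |∂f/∂u(x,t) + 1/λ|`, with values in `[0,∞]`. -/
def sigma {d : ℕ} (Ω : Set (Space d)) (f : Space d → ℝ → ℝ) (lam : ℝ) : ℝ≥0∞ :=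
  essSup (fun x => ⨆ t : ℝ, ‖deriv (f x) t + 1 / lam‖ₑ) (volume.restrict Ω)

/-- `Λ_f(ρ) = {λ > 0 : σ_f(λ) < ρ + 1/λ}`. -/
def Lambda {d : ℕ} (Ω : Set (Space d)) (f : Space d → ℝ → ℝ) (ρ : ℝ) : Set ℝ :=
  {lam : ℝ | 0 < lam ∧ sigma Ω f lam < ENNReal.ofReal (ρ + 1 / lam)}

/-- The structural assumptions on the nonlinearity `f`, with the constant `ρ`. -/
structure IsAdmissible {d : ℕ} (Ω : Set (Space d)) (f : Space d → ℝ → ℝ) (ρ : ℝ) : Prop where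
  memLp_zero : MemLp (fun x => f x 0) 2 (volume.restrict Ω)
  differentiable : ∀ x ∈ Ω, Differentiable ℝ (f x)
  rho_pos : 0 < ρ
  nonempty : (Lambda Ω f ρ).Nonempty

open Classical in
/-- `μ_f = (sup Λ_f(ρ))⁻¹` if `sup Λ_f(ρ) < ∞`, and `μ_f = 0` otherwise. -/
def mu {d : ℕ} (Ω : Set (Space d)) (f : Space d → ℝ → ℝ) (ρ : ℝ) : ℝ :=
  if BddAbove (Lambda Ω f ρ) then (sSup (Lambda Ω f ρ))⁻¹ else 0

/-- `κ_f = max {μ_f + ρ/2 - 1/(2 C_P), 0}`. -/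
def kappa {d : ℕ} (Ω : Set (Space d)) (f : Space d → ℝ → ℝ) (ρ : ℝ) : ℝ :=
  max (mu Ω f ρ + ρ / 2 - 1 / (2 * poincareConst Ω)) 0

/-- The bilinear form `B_λ(u,v) = ∫_Ω (λ ∇u · ∇v + u v)`. -/
def bilin {d : ℕ} {Ω : Set (Space d)} (lam : ℝ) (u v : H10 Ω) : ℝ :=
  ∫ x in Ω, (lam * ⟪grad u x, grad v x⟫_ℝ + fn u x * fn v x)

/-- The linear form `ℓ_λ(y; v) = ∫_Ω (y + λ f(x,y)) v`, for `y ∈ L²(Ω)`. -/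
def linForm {d : ℕ} {Ω : Set (Space d)} (f : Space d → ℝ → ℝ) (lam : ℝ) (y : L2 Ω)
    (v : H10 Ω) : ℝ :=
  ∫ x in Ω, (y x + lam * f x (y x)) * fn v x

/-- The sequence `u¹, u², … ∈ V` is generated by the iteration
`B_Δt(u^{n+1}, v) = ℓ_Δt(u^n; v)` for all `v ∈ V`, with the initial guess `u⁰ ∈ L²(Ω)`.
As `u⁰` need not lie in `V`, the iterates are numbered from `u n = u^{n+1}`. -/
def IsIteration {d : ℕ} {Ω : Set (Space d)} (f : Space d → ℝ → ℝ) (dt : ℝ) (u₀ : L2 Ω)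
    (u : ℕ → H10 Ω) : Prop :=
  (∀ v : H10 Ω, bilin dt (u 0) v = linForm f dt u₀ v) ∧
    ∀ n : ℕ, ∀ v : H10 Ω, bilin dt (u (n + 1)) v = linForm f dt (fn (u n)) v

end Semilinear

end

noncomputable section

namespace Semilinear

theorem sq_lintegral_enorm_le {α F : Type*} [MeasurableSpace α] [NormedAddCommGroup F]
    {μ : Measure α} [IsProbabilityMeasure μ] {g : α → F} (hg : AEStronglyMeasurable g μ) :
    (∫⁻ a, ‖g a‖ₑ ∂μ) ^ 2 ≤ ∫⁻ a, ‖g a‖ₑ ^ 2 ∂μ := by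
  have h := eLpNorm_le_eLpNorm_of_exponent_le (p := 1) (q := 2) (by norm_num) hg
  rw [eLpNorm_one_eq_lintegral_enorm] at h
  have h2 := eLpNorm_nnreal_pow_eq_lintegral (f := g) (μ := μ) (p := 2) (by norm_num)
  simp only [ENNReal.coe_ofNat, NNReal.coe_ofNat, ENNReal.rpow_ofNat] at h2
  rw [← h2]
  gcongr

theorem enorm_translate_sub_sq_le {d : ℕ} {φ : Space d → ℝ} (hφ : ContDiff ℝ 1 φ)
    (x z : Space d) :
    ‖φ (x + z) - φ x‖ₑ ^ 2 ≤
      ‖z‖ₑ ^ 2 * ∫⁻ t in Ioc (0 : ℝ) 1, ‖fderiv ℝ φ (x + t • z)‖ₑ ^ 2 := by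
  have hc : Continuous fun t : ℝ => fderiv ℝ φ (x + t • z) :=
    (hφ.continuous_fderiv (by simp)).comp (by fun_prop)
  have hderiv : ∀ t ∈ uIcc (0 : ℝ) 1,
      HasDerivAt (fun t : ℝ => φ (x + t • z)) (fderiv ℝ φ (x + t • z) z) t := by
    intro t _
    have h1 : HasDerivAt (fun t : ℝ => x + t • z) z t := by
      simpa using ((hasDerivAt_id t).smul_const z).const_add x
    exact ((hφ.differentiable (by simp) _).hasFDerivAt).comp_hasDerivAt t h1
  have hint := intervalIntegral.integral_eq_sub_of_hasDerivAt hderiv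
    ((hc.clm_apply continuous_const).intervalIntegrable 0 1)
  simp only [one_smul, zero_smul, add_zero] at hint
  rw [← hint, intervalIntegral.integral_of_le zero_le_one]
  have : IsProbabilityMeasure (volume.restrict (Ioc (0 : ℝ) 1)) := ⟨by simp⟩
  calc ‖∫ t in Ioc (0 : ℝ) 1, fderiv ℝ φ (x + t • z) z‖ₑ ^ 2
      ≤ (∫⁻ t in Ioc (0 : ℝ) 1, ‖fderiv ℝ φ (x + t • z) z‖ₑ) ^ 2 := by
        gcongr; exact enorm_integral_le_lintegral_enorm _
    _ ≤ (∫⁻ t in Ioc (0 : ℝ) 1, ‖z‖ₑ * ‖fderiv ℝ φ (x + t • z)‖ₑ) ^ 2 := by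
        gcongr with t
        rw [mul_comm]
        exact ContinuousLinearMap.le_opENorm _ _
    _ = ‖z‖ₑ ^ 2 * (∫⁻ t in Ioc (0 : ℝ) 1, ‖fderiv ℝ φ (x + t • z)‖ₑ) ^ 2 := by
        rw [lintegral_const_mul _ hc.enorm.measurable, mul_pow]
    _ ≤ _ := by
        gcongr
        exact sq_lintegral_enorm_le hc.aestronglyMeasurable

theorem lintegral_enorm_translate_sub_sq_le {d : ℕ} {φ : Space d → ℝ} (hφ : ContDiff ℝ 1 φ)
    (z : Space d) :
    ∫⁻ x, ‖φ (x + z) - φ x‖ₑ ^ 2 ≤ ‖z‖ₑ ^ 2 * ∫⁻ x, ‖fderiv ℝ φ x‖ₑ ^ 2 := by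
  have hc : Continuous fun p : Space d × ℝ => ‖fderiv ℝ φ (p.1 + p.2 • z)‖ₑ ^ 2 :=
    (ENNReal.continuous_pow 2).comp
      ((hφ.continuous_fderiv (by simp)).comp (by fun_prop)).enorm
  calc ∫⁻ x, ‖φ (x + z) - φ x‖ₑ ^ 2
      ≤ ∫⁻ x, ‖z‖ₑ ^ 2 * ∫⁻ t in Ioc (0 : ℝ) 1, ‖fderiv ℝ φ (x + t • z)‖ₑ ^ 2 :=
        lintegral_mono fun x => enorm_translate_sub_sq_le hφ x z
    _ = ‖z‖ₑ ^ 2 * ∫⁻ x, ∫⁻ t in Ioc (0 : ℝ) 1, ‖fderiv ℝ φ (x + t • z)‖ₑ ^ 2 :=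
        lintegral_const_mul _ (Measurable.lintegral_prod_right hc.measurable)
    _ = ‖z‖ₑ ^ 2 * ∫⁻ t in Ioc (0 : ℝ) 1, ∫⁻ x, ‖fderiv ℝ φ (x + t • z)‖ₑ ^ 2 := by
        rw [lintegral_lintegral_swap hc.measurable.aemeasurable]
    _ = ‖z‖ₑ ^ 2 * ∫⁻ x, ‖fderiv ℝ φ x‖ₑ ^ 2 := by
        congr 1
        have : ∀ t : ℝ, ∫⁻ x, ‖fderiv ℝ φ (x + t • z)‖ₑ ^ 2 = ∫⁻ x, ‖fderiv ℝ φ x‖ₑ ^ 2 :=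
          fun t => lintegral_add_right_eq_self (fun x => ‖fderiv ℝ φ x‖ₑ ^ 2) (t • z)
        simp [this]

/-- A pointwise bound by the oscillation of `φ` and its mean over a ball. -/
theorem volume_mul_sq_le {d : ℕ} {φ : Space d → ℝ} (hφ : Continuous φ) {h : ℝ} (hh : 0 < h)
    {x p : Space d} (hx : x ∈ Metric.ball p h) :
    (volume.real (Metric.ball (0 : Space d) h)) * φ x ^ 2 ≤
      2 * (∫ z in Metric.ball (0 : Space d) (2 * h), (φ (x + z) - φ x) ^ 2) +
      4 / volume.real (Metric.ball (0 : Space d) h) * (∫ y in Metric.ball p h, φ y) ^ 2 := by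
  have hintg : ∀ {ψ : Space d → ℝ} (_ : Continuous ψ) (c : Space d) (r : ℝ),
      IntegrableOn ψ (Metric.ball c r) := fun hψ c r =>
    (hψ.continuousOn.integrableOn_compact (isCompact_closedBall c r)).mono_set
      Metric.ball_subset_closedBall
  set V := volume.real (Metric.ball (0 : Space d) h) with hV
  have hVp : volume.real (Metric.ball p h) = V := by
    simp only [hV, Measure.real, Measure.addHaar_ball_center]
  have hV0 : 0 < V := ENNReal.toReal_pos (Metric.measure_ball_pos _ _ hh).ne'
    measure_ball_lt_top.ne
  set m := ∫ y in Metric.ball p h, φ y with hm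
  have h1 : V * φ x ^ 2 ≤ (∫ y in Metric.ball p h, (φ y - φ x) ^ 2) + 2 * φ x * m := by
    have : ∫ _y in Metric.ball p h, φ x ^ 2 = V * φ x ^ 2 := by simp [hVp]
    rw [← this, hm, ← integral_const_mul, ← integral_add (hintg (by fun_prop) _ _)
      (hintg (by fun_prop) _ _)]
    refine integral_mono (hintg (by fun_prop) _ _) (hintg (by fun_prop) _ _) fun y => ?_
    simp only
    nlinarith [sq_nonneg (φ y)]
  have h2 : ∫ y in Metric.ball p h, (φ y - φ x) ^ 2 ≤
      ∫ z in Metric.ball (0 : Space d) (2 * h), (φ (x + z) - φ x) ^ 2 := by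
    have e : ∫ z in Metric.ball (0 : Space d) (2 * h), (φ (x + z) - φ x) ^ 2 =
        ∫ y in Metric.ball x (2 * h), (φ y - φ x) ^ 2 := by
      have := (measurePreserving_add_left (volume : Measure (Space d)) x).setIntegral_preimage_emb
        (measurableEmbedding_addLeft x) (fun y => (φ y - φ x) ^ 2) (Metric.ball x (2 * h))
      rw [← this]
      congr 2
      ext z
      simp
    rw [e]
    refine setIntegral_mono_set (hintg (by fun_prop) _ _)
      (ae_of_all _ fun y => sq_nonneg _) (LE.le.eventuallyLE ?_)
    refine Metric.ball_subset_ball' ?_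
    have : dist p x < h := by rw [dist_comm]; exact hx
    linarith
  have h3 : 2 * φ x * m ≤ V * φ x ^ 2 / 2 + 2 / V * m ^ 2 := by
    have : 0 ≤ (V * φ x - 2 * m) ^ 2 / (2 * V) := by positivity
    have e : (V * φ x - 2 * m) ^ 2 / (2 * V) =
        V * φ x ^ 2 / 2 + 2 / V * m ^ 2 - 2 * φ x * m := by field_simp; ring
    linarith
  have e4 : 4 / V * m ^ 2 = 2 * (2 / V * m ^ 2) := by ring
  linarith

/-- The `L²`-norm of a `C¹` function on a set covered by balls of radius `h` is controlled by its
gradient and its means over these balls. -/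
theorem volume_mul_lintegral_sq_le {d : ℕ} {φ : Space d → ℝ} (hφ : ContDiff ℝ 1 φ) {h : ℝ}
    (hh : 0 < h) {Ω : Set (Space d)} {t : Finset (Space d)}
    (ht : Ω ⊆ ⋃ p ∈ t, Metric.ball p h) (hΩm : MeasurableSet Ω) :
    volume (Metric.ball (0 : Space d) h) * ∫⁻ x in Ω, ‖φ x‖ₑ ^ 2 ≤
      2 * (volume (Metric.ball (0 : Space d) (2 * h)) *
        (ENNReal.ofReal (2 * h) ^ 2 * ∫⁻ x, ‖fderiv ℝ φ x‖ₑ ^ 2)) +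
      ENNReal.ofReal (4 / volume.real (Metric.ball (0 : Space d) h) *
        ∑ p ∈ t, (∫ y in Metric.ball p h, φ y) ^ 2) * volume Ω := by
  set K := 4 / volume.real (Metric.ball (0 : Space d) h) *
        ∑ p ∈ t, (∫ y in Metric.ball p h, φ y) ^ 2 with hK
  have hφc := hφ.continuous
  have sq : ∀ a : ℝ, ENNReal.ofReal (a ^ 2) = ‖a‖ₑ ^ 2 := fun a => by
    rw [← sq_abs, ENNReal.ofReal_pow (abs_nonneg a), ← Real.norm_eq_abs, ofReal_norm]
  have hcz : Continuous fun q : Space d × Space d => ‖φ (q.1 + q.2) - φ q.1‖ₑ ^ 2 :=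
    (ENNReal.continuous_pow 2).comp (Continuous.enorm (by fun_prop))
  have hpt : ∀ x ∈ Ω, volume (Metric.ball (0 : Space d) h) * ‖φ x‖ₑ ^ 2 ≤
      2 * (∫⁻ z in Metric.ball (0 : Space d) (2 * h), ‖φ (x + z) - φ x‖ₑ ^ 2) +
        ENNReal.ofReal K := by
    intro x hx
    obtain ⟨p, hp, hxp⟩ := mem_iUnion₂.1 (ht hx)
    have key := volume_mul_sq_le hφc hh hxp
    have key2 : volume.real (Metric.ball (0 : Space d) h) * φ x ^ 2 ≤
      2 * (∫ z in Metric.ball (0 : Space d) (2 * h), (φ (x + z) - φ x) ^ 2) + K := by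
      refine key.trans ?_
      rw [hK]
      gcongr
      exact Finset.single_le_sum (f := fun p => (∫ y in Metric.ball p h, φ y) ^ 2)
        (fun _ _ => sq_nonneg _) hp
    have hint : IntegrableOn (fun z => (φ (x + z) - φ x) ^ 2)
        (Metric.ball (0 : Space d) (2 * h)) := by
      have hc : Continuous fun z => (φ (x + z) - φ x) ^ 2 := by fun_prop
      exact (hc.continuousOn.integrableOn_compact (isCompact_closedBall 0 (2 * h))).mono_set
        Metric.ball_subset_closedBall
    have e1 : ENNReal.ofReal (∫ z in Metric.ball (0 : Space d) (2 * h), (φ (x + z) - φ x) ^ 2) =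
        ∫⁻ z in Metric.ball (0 : Space d) (2 * h), ‖φ (x + z) - φ x‖ₑ ^ 2 := by
      rw [ofReal_integral_eq_lintegral_ofReal hint (ae_of_all _ fun _ => sq_nonneg _)]
      exact lintegral_congr fun z => sq _
    have e2 : ENNReal.ofReal (volume.real (Metric.ball (0 : Space d) h)) =
        volume (Metric.ball (0 : Space d) h) := ENNReal.ofReal_toReal measure_ball_lt_top.ne
    calc volume (Metric.ball (0 : Space d) h) * ‖φ x‖ₑ ^ 2
        = ENNReal.ofReal (volume.real (Metric.ball (0 : Space d) h) * φ x ^ 2) := by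
          rw [ENNReal.ofReal_mul measureReal_nonneg, e2, sq]
      _ ≤ ENNReal.ofReal (2 * (∫ z in Metric.ball (0 : Space d) (2 * h),
            (φ (x + z) - φ x) ^ 2) + K) := ENNReal.ofReal_le_ofReal key2
      _ ≤ ENNReal.ofReal (2 * (∫ z in Metric.ball (0 : Space d) (2 * h),
            (φ (x + z) - φ x) ^ 2)) + ENNReal.ofReal K := ENNReal.ofReal_add_le
      _ = _ := by rw [ENNReal.ofReal_mul (by norm_num), ENNReal.ofReal_ofNat, e1]
  have hmD : Measurable fun x => ∫⁻ z in Metric.ball (0 : Space d) (2 * h),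
      ‖φ (x + z) - φ x‖ₑ ^ 2 := Measurable.lintegral_prod_right hcz.measurable
  calc volume (Metric.ball (0 : Space d) h) * ∫⁻ x in Ω, ‖φ x‖ₑ ^ 2
      = ∫⁻ x in Ω, volume (Metric.ball (0 : Space d) h) * ‖φ x‖ₑ ^ 2 :=
        (lintegral_const_mul _ (hφc.enorm.measurable.pow_const 2)).symm
    _ ≤ ∫⁻ x in Ω, (2 * (∫⁻ z in Metric.ball (0 : Space d) (2 * h), ‖φ (x + z) - φ x‖ₑ ^ 2) +
        ENNReal.ofReal K) := setLIntegral_mono' hΩm hpt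
    _ = 2 * (∫⁻ x in Ω, ∫⁻ z in Metric.ball (0 : Space d) (2 * h), ‖φ (x + z) - φ x‖ₑ ^ 2) +
        ENNReal.ofReal K * volume Ω := by
        rw [lintegral_add_left (hmD.const_mul 2), lintegral_const_mul _ hmD, setLIntegral_const]
    _ ≤ _ := by
        gcongr
        calc ∫⁻ x in Ω, ∫⁻ z in Metric.ball (0 : Space d) (2 * h), ‖φ (x + z) - φ x‖ₑ ^ 2
            ≤ ∫⁻ x, ∫⁻ z in Metric.ball (0 : Space d) (2 * h), ‖φ (x + z) - φ x‖ₑ ^ 2 :=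
              setLIntegral_le_lintegral _ _
          _ = ∫⁻ z in Metric.ball (0 : Space d) (2 * h), ∫⁻ x, ‖φ (x + z) - φ x‖ₑ ^ 2 :=
              lintegral_lintegral_swap hcz.measurable.aemeasurable
          _ ≤ ∫⁻ z in Metric.ball (0 : Space d) (2 * h),
                ENNReal.ofReal (2 * h) ^ 2 * ∫⁻ x, ‖fderiv ℝ φ x‖ₑ ^ 2 := by
              refine setLIntegral_mono' measurableSet_ball fun z hz => ?_
              refine (lintegral_enorm_translate_sub_sq_le hφ z).trans ?_
              gcongr
              rw [← ofReal_norm]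
              exact ENNReal.ofReal_le_ofReal (mem_ball_zero_iff.1 hz).le
          _ = _ := by rw [setLIntegral_const, mul_comm]

theorem enorm_Lp_two_sq {α F : Type*} [MeasurableSpace α] [NormedAddCommGroup F]
    {μ : Measure α} (u : Lp F 2 μ) :
    ENNReal.ofReal (‖u‖ ^ 2) = ∫⁻ x, ‖u x‖ₑ ^ 2 ∂μ := by
  have h2 := eLpNorm_nnreal_pow_eq_lintegral (f := u) (μ := μ) (p := 2) (by norm_num)
  simp only [ENNReal.coe_ofNat, NNReal.coe_ofNat, ENNReal.rpow_ofNat] at h2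
  rw [← h2, ENNReal.ofReal_pow (norm_nonneg _), Lp.norm_def,
    ENNReal.ofReal_toReal (Lp.eLpNorm_ne_top u)]

theorem norm_fst_sq_le_of_mem_testSubmodule {d : ℕ} {Ω : Set (Space d)} (hΩ : MeasurableSet Ω)
    (hΩb : volume Ω ≠ ⊤) {h : ℝ} (hh : 0 < h) {t : Finset (Space d)}
    (ht : Ω ⊆ ⋃ p ∈ t, Metric.ball p h) {w : Pairs Ω} (hw : w ∈ testSubmodule Ω) :
    volume.real (Metric.ball (0 : Space d) h) * ‖w.fst‖ ^ 2 ≤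
      2 * (volume.real (Metric.ball (0 : Space d) (2 * h)) * ((2 * h) ^ 2 * ‖w.snd‖ ^ 2)) +
      4 / volume.real (Metric.ball (0 : Space d) h) *
        (∑ p ∈ t, (∫ y in Metric.ball p h, w.fst y ∂(volume.restrict Ω)) ^ 2) *
          volume.real Ω := by
  obtain ⟨φ, hφ, h1, h2⟩ := hw
  have hφ1 : ContDiff ℝ 1 φ := hφ.contDiff.of_le (by norm_cast)
  have key := volume_mul_lintegral_sq_le hφ1 hh ht hΩ
  have e1 : ∫⁻ x in Ω, ‖φ x‖ₑ ^ 2 = ENNReal.ofReal (‖w.fst‖ ^ 2) := by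
    rw [enorm_Lp_two_sq]
    refine lintegral_congr_ae ?_
    filter_upwards [h1] with x hx
    rw [hx]
  have e2 : ∫⁻ x, ‖fderiv ℝ φ x‖ₑ ^ 2 = ENNReal.ofReal (‖w.snd‖ ^ 2) := by
    have hsupp : Function.support (fun x => ‖fderiv ℝ φ x‖ₑ ^ 2) ⊆ Ω := by
      intro x hx
      refine hφ.tsupport_subset (support_fderiv_subset ℝ ?_)
      intro h
      refine hx ?_
      simp only [h, enorm_zero (E := Space d →L[ℝ] ℝ)]
      simp
    rw [enorm_Lp_two_sq, ← setLIntegral_eq_of_support_subset hsupp]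
    refine lintegral_congr_ae ?_
    filter_upwards [h2] with x hx
    rw [hx, gradient, LinearIsometryEquiv.enorm_map]
  have e3 : ∀ p, ∫ y in Metric.ball p h, φ y =
      ∫ y in Metric.ball p h, w.fst y ∂(volume.restrict Ω) := by
    intro p
    rw [setIntegral_congr_ae (g := φ) measurableSet_ball (h1.mono fun x hx _ => hx),
      Measure.restrict_restrict measurableSet_ball, inter_comm, ← Measure.restrict_restrict hΩ]
    refine (setIntegral_eq_integral_of_forall_compl_eq_zero fun x hx => ?_).symm
    exact image_eq_zero_of_notMem_tsupport fun h => hx (hφ.tsupport_subset h)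
  simp only [e3] at key
  rw [e1, e2] at key
  have hA : 2 * (volume (Metric.ball (0 : Space d) (2 * h)) *
      (ENNReal.ofReal (2 * h) ^ 2 * ENNReal.ofReal (‖w.snd‖ ^ 2))) ≠ ⊤ :=
    ENNReal.mul_ne_top (by simp) (ENNReal.mul_ne_top measure_ball_lt_top.ne
      (ENNReal.mul_ne_top (ENNReal.pow_ne_top ENNReal.ofReal_ne_top) ENNReal.ofReal_ne_top))
  have hB : ENNReal.ofReal (4 / volume.real (Metric.ball (0 : Space d) h) *
      ∑ p ∈ t, (∫ y in Metric.ball p h, w.fst y ∂(volume.restrict Ω)) ^ 2) * volume Ω ≠ ⊤ :=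
    ENNReal.mul_ne_top (by simp) hΩb
  have := ENNReal.toReal_mono (ENNReal.add_ne_top.2 ⟨hA, hB⟩) key
  rw [ENNReal.toReal_add hA hB] at this
  simp only [ENNReal.toReal_mul, ENNReal.toReal_pow] at this
  rw [ENNReal.toReal_ofReal (by positivity), ENNReal.toReal_ofReal (by positivity),
    ENNReal.toReal_ofReal (by positivity), ENNReal.toReal_ofReal (mul_nonneg (by positivity)
      (Finset.sum_nonneg fun _ _ => sq_nonneg _))] at this
  exact this

/-- The `L²`-norm on `H¹_0(Ω)` is bounded by finitely many functionals, up to a small multiple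
of the norm of the gradient. -/
theorem exists_norm_fn_sq_le {d : ℕ} {Ω : Set (Space d)} (hΩ : IsOpen Ω)
    (hΩb : Bornology.IsBounded Ω) {ε : ℝ} (hε : 0 < ε) :
    ∃ (C : ℝ) (t : Finset (Space d)) (g : Space d → L2 Ω), ∀ v : H10 Ω,
      ‖fn v‖ ^ 2 ≤ ε * ‖grad v‖ ^ 2 + C * ∑ p ∈ t, ⟪g p, fn v⟫_ℝ ^ 2 := by
  set h : ℝ := Real.sqrt (ε / (8 * 2 ^ d)) with hh
  have h0 : 0 < h := by positivity
  have hsq : h ^ 2 = ε / (8 * 2 ^ d) := Real.sq_sqrt (by positivity)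
  obtain ⟨t, htf, ht⟩ := Metric.totallyBounded_iff.1
    (hΩb.isCompact_closure.totallyBounded.subset subset_closure) h h0
  have hvol : volume Ω ≠ ⊤ := hΩb.measure_lt_top.ne
  set V := volume.real (Metric.ball (0 : Space d) h) with hV
  have hV0 : 0 < V := ENNReal.toReal_pos (Metric.measure_ball_pos _ _ h0).ne'
    measure_ball_lt_top.ne
  have hV2 : volume.real (Metric.ball (0 : Space d) (2 * h)) = 2 ^ d * V := by
    rw [hV, Measure.real, Measure.addHaar_ball_mul_of_pos _ _ two_pos, ENNReal.toReal_mul,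
      ENNReal.toReal_ofReal (by positivity), finrank_euclideanSpace_fin]
    rfl
  let g : Space d → L2 Ω := fun p => indicatorConstLp 2
    (measurableSet_ball (x := p) (ε := h)) (measure_ball_lt_top.ne) (1 : ℝ)
  have hg : ∀ p (u : L2 Ω), ⟪g p, u⟫_ℝ = ∫ y in Metric.ball p h, u y ∂(volume.restrict Ω) :=
    fun p u => L2.inner_indicatorConstLp_one _ _ _
  set C := 4 / V * volume.real Ω / V with hC
  refine ⟨C, htf.toFinset, g, ?_⟩
  have hcl : IsClosed {w : Pairs Ω | ‖w.fst‖ ^ 2 ≤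
      ε * ‖w.snd‖ ^ 2 + C * ∑ p ∈ htf.toFinset, ⟪g p, w.fst⟫_ℝ ^ 2} := by
    refine isClosed_le (by fun_prop) ?_
    refine Continuous.add (by fun_prop) (continuous_const.mul (continuous_finsetSum _ fun p _ => ?_))
    exact (Continuous.inner continuous_const (by fun_prop)).pow 2
  have hle : (H10 Ω : Set (Pairs Ω)) ⊆ _ := closure_minimal ?_ hcl
  · exact fun v => hle v.2
  intro w hw
  have key := norm_fst_sq_le_of_mem_testSubmodule hΩ.measurableSet hvol h0
    (t := htf.toFinset) (by simpa using ht) hw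
  simp only [← hg] at key
  rw [hV2, ← hV, mul_pow, hsq] at key
  rw [Set.mem_ofPred_eq, ← mul_le_mul_iff_right₀ hV0]
  refine key.trans (le_of_eq ?_)
  rw [hC]
  field_simp
  ring

/-- The compactness of the embedding of `H¹_0(Ω)` into `L²(Ω)` (Rellich). -/
theorem exists_subseq_tendsto_fn {d : ℕ} {Ω : Set (Space d)} (hΩ : IsOpen Ω)
    (hΩb : Bornology.IsBounded Ω) {v : ℕ → H10 Ω} {R : ℝ} (hR : ∀ n, ‖v n‖ ≤ R) :
    ∃ (y : L2 Ω) (φ : ℕ → ℕ), StrictMono φ ∧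
      Tendsto (fun k => fn (v (φ k))) atTop (𝓝 y) := by
  have hfn : ∀ w : H10 Ω, ‖fn w‖ ≤ ‖w‖ := fun w => WithLp.norm_fst_le _ _
  have hgr : ∀ w : H10 Ω, ‖grad w‖ ≤ ‖w‖ := fun w => WithLp.norm_snd_le _ _
  have hcau : Cauchy (map (fun n => fn (v n)) (hyperfilter ℕ : Filter ℕ)) := by
    rw [cauchy_map_iff]
    refine ⟨inferInstance, ?_⟩
    rw [Metric.uniformity_eq_comap_nhds_zero, tendsto_comap_iff, Metric.tendsto_nhds]
    intro ε hε
    have hR0 : 0 ≤ R := (norm_nonneg _).trans (hR 0)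
    obtain ⟨C, t, g, hg⟩ := exists_norm_fn_sq_le hΩ hΩb
      (ε := ε ^ 2 / 2 / ((2 * R) ^ 2 + 1)) (by positivity)
    have hlim : ∀ p, ∃ a, Tendsto (fun n => ⟪g p, fn (v n)⟫_ℝ) (hyperfilter ℕ : Filter ℕ)
        (𝓝 a) := by
      intro p
      have hb : ∀ n, ⟪g p, fn (v n)⟫_ℝ ∈ Icc (-(‖g p‖ * R)) (‖g p‖ * R) := fun n => by
        rw [mem_Icc, ← abs_le]
        refine (abs_real_inner_le_norm _ _).trans ?_
        gcongr
        exact (hfn _).trans (hR n)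
      obtain ⟨a, -, ha⟩ := isCompact_Icc.ultrafilter_le_nhds
        ((hyperfilter ℕ).map fun n => ⟪g p, fn (v n)⟫_ℝ)
        (by
          rw [Ultrafilter.coe_map, le_principal_iff]
          exact mem_map.2 (univ_mem' hb))
      exact ⟨a, ha⟩
    choose a ha using hlim
    have hsum : Tendsto (fun q : ℕ × ℕ => C * ∑ p ∈ t,
        (⟪g p, fn (v q.1)⟫_ℝ - ⟪g p, fn (v q.2)⟫_ℝ) ^ 2)
        ((hyperfilter ℕ : Filter ℕ) ×ˢ (hyperfilter ℕ : Filter ℕ)) (𝓝 0) := by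
      have : (0 : ℝ) = C * ∑ p ∈ t, (a p - a p) ^ 2 := by simp
      rw [this]
      exact (tendsto_finsetSum _ fun p _ =>
        (((ha p).comp tendsto_fst).sub ((ha p).comp tendsto_snd)).pow 2).const_mul C
    filter_upwards [hsum.eventually_lt_const (show (0 : ℝ) < ε ^ 2 / 2 by positivity)] with q hq
    have h1 := hg (v q.1 - v q.2)
    have e : fn (v q.1 - v q.2) = fn (v q.1) - fn (v q.2) := rfl
    have h2 : ‖grad (v q.1 - v q.2)‖ ≤ 2 * R := by
      refine (hgr _).trans ((norm_sub_le _ _).trans ?_)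
      linarith [hR q.1, hR q.2]
    simp only [e, inner_sub_right] at h1
    have h3 : ε ^ 2 / 2 / ((2 * R) ^ 2 + 1) * ‖grad (v q.1 - v q.2)‖ ^ 2 ≤ ε ^ 2 / 2 := by
      rw [div_mul_eq_mul_div, div_le_iff₀ (by positivity)]
      gcongr
      have := pow_le_pow_left₀ (norm_nonneg _) h2 2
      linarith
    have h4 : ‖fn (v q.1) - fn (v q.2)‖ ^ 2 < ε ^ 2 := by linarith
    simpa [dist_eq_norm] using lt_of_pow_lt_pow_left₀ 2 hε.le h4
  obtain ⟨y, hy⟩ := cauchy_iff_exists_le_nhds.1 hcau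
  have hle : (hyperfilter ℕ : Filter ℕ) ≤ atTop := by
    rw [← Nat.cofinite_eq_atTop]; exact hyperfilter_le_cofinite
  have hcp : MapClusterPt y atTop fun n => fn (v n) :=
    (ClusterPt.of_le_nhds hy).mono (map_mono hle)
  exact ⟨y, MapClusterPt.tendsto_subseq hcp⟩

/-- A nonlinearity with Lipschitz constant `L` in the second variable that gives rise to
measurable superposition operators. -/
structure IsLipschitzNonlinearity {d : ℕ} (Ω : Set (Space d)) (f : Space d → ℝ → ℝ) (L : ℝ) :
    Prop where
  memLp_zero : MemLp (fun x => f x 0) 2 (volume.restrict Ω)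
  aestronglyMeasurable : ∀ y : L2 Ω,
    AEStronglyMeasurable (fun x => f x (y x)) (volume.restrict Ω)
  aestronglyMeasurable_primitive : ∀ y : L2 Ω,
    AEStronglyMeasurable (fun x => primitive f x (y x)) (volume.restrict Ω)
  nonneg : 0 ≤ L
  lipschitz : ∀ᵐ x ∂(volume.restrict Ω), ∀ s t, |f x s - f x t| ≤ L * |s - t|

theorem abs_integral_sub_le_of_lipschitz {g : ℝ → ℝ} {L : ℝ}
    (hg : ∀ s t, |g s - g t| ≤ L * |s - t|) (s t : ℝ) :
    |(∫ r in (0 : ℝ)..t, g r) - (∫ r in (0 : ℝ)..s, g r) - g s * (t - s)| ≤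
      L / 2 * (t - s) ^ 2 := by
  have hL : 0 ≤ L := by simpa using (abs_nonneg _).trans (hg 1 0)
  have hc : Continuous g := (LipschitzWith.of_dist_le_mul (K := ⟨L, hL⟩) fun s t => hg s t).continuous
  have hi : ∀ a b, IntervalIntegrable g volume a b := hc.intervalIntegrable
  have e : (∫ r in (0 : ℝ)..t, g r) - (∫ r in (0 : ℝ)..s, g r) - g s * (t - s) =
      ∫ r in s..t, (g r - g s) := by
    rw [intervalIntegral.integral_interval_sub_left (hi _ _) (hi _ _),
      intervalIntegral.integral_sub (hi _ _) (by simp), intervalIntegral.integral_const]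
    simp [mul_comm]
  rw [e, ← Real.norm_eq_abs]
  refine (intervalIntegral.norm_integral_le_abs_of_norm_le (g := fun r => L * |r - s|)
    (ae_of_all _ fun r => hg r s) (Continuous.intervalIntegrable (by fun_prop) _ _)).trans ?_
  have hint : ∫ r in s..t, (r - s) = (t - s) ^ 2 / 2 := by
    rw [intervalIntegral.integral_sub (by simp) (by simp), integral_id]
    simp
    ring
  rw [intervalIntegral.integral_const_mul]
  rcases le_total s t with h | h
  · have : ∫ r in s..t, |r - s| = ∫ r in s..t, (r - s) := by
      refine intervalIntegral.integral_congr fun r hr => ?_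
      rw [uIcc_of_le h] at hr
      exact abs_of_nonneg (sub_nonneg.2 hr.1)
    rw [this, hint, abs_of_nonneg (by positivity)]
    linarith
  · have : ∫ r in s..t, |r - s| = ∫ r in s..t, -(r - s) := by
      refine intervalIntegral.integral_congr fun r hr => ?_
      rw [uIcc_of_ge h] at hr
      exact abs_of_nonpos (sub_nonpos.2 hr.2)
    rw [this, intervalIntegral.integral_neg, hint, mul_neg, abs_neg,
      abs_of_nonneg (by positivity)]
    linarith

theorem exists_continuous_extension {d : ℕ} {Ω : Set (Space d)} {f : Space d → ℝ → ℝ}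
    (hfc : ContinuousOn (fun p : Space d × ℝ => f p.1 p.2) (closure Ω ×ˢ Set.univ)) :
    ∃ F : Space d → ℝ → ℝ, Continuous (Function.uncurry F) ∧ ∀ x ∈ Ω, F x = f x := by
  obtain ⟨G, hG⟩ := ContinuousMap.exists_restrict_eq
    (isClosed_closure.prod isClosed_univ : IsClosed (closure Ω ×ˢ (Set.univ : Set ℝ)))
    ⟨_, continuousOn_iff_continuous_domRestrict.1 hfc⟩
  refine ⟨fun x t => G (x, t), G.continuous, fun x hx => funext fun t => ?_⟩
  exact DFunLike.congr_fun hG ⟨(x, t), subset_closure hx, trivial⟩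

theorem ae_lipschitz_of_mem_Lambda {d : ℕ} {Ω : Set (Space d)} (hΩ : MeasurableSet Ω)
    {f : Space d → ℝ → ℝ} (hd : ∀ x ∈ Ω, Differentiable ℝ (f x)) {ρ lam : ℝ}
    (hlam : lam ∈ Lambda Ω f ρ) :
    ∀ᵐ x ∂(volume.restrict Ω), ∀ s t, |f x s - f x t| ≤ (ρ + 2 / lam) * |s - t| := by
  obtain ⟨h0, hs⟩ := hlam
  filter_upwards [ENNReal.ae_le_essSup (μ := volume.restrict Ω)
    (fun x => ⨆ t : ℝ, ‖deriv (f x) t + 1 / lam‖ₑ), ae_restrict_mem hΩ] with x hx hxΩ s t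
  have hpos : 0 < ρ + 1 / lam := ENNReal.ofReal_pos.1 (bot_lt_of_lt hs)
  have hder : ∀ r, ‖deriv (f x) r‖ ≤ ρ + 2 / lam := by
    intro r
    have h1 : ‖deriv (f x) r + 1 / lam‖ₑ ≤ ENNReal.ofReal (ρ + 1 / lam) :=
      ((le_iSup (fun t : ℝ => ‖deriv (f x) t + 1 / lam‖ₑ) r).trans hx).trans hs.le
    rw [← ofReal_norm, ENNReal.ofReal_le_ofReal_iff hpos.le] at h1
    have h2 : ‖deriv (f x) r‖ ≤ ‖deriv (f x) r + 1 / lam‖ + ‖1 / lam‖ := by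
      simpa using norm_sub_le (deriv (f x) r + 1 / lam) (1 / lam)
    rw [Real.norm_of_nonneg (by positivity : 0 ≤ 1 / lam)] at h2
    have e : 2 / lam = 1 / lam + 1 / lam := by ring
    linarith
  exact convex_univ.norm_image_sub_le_of_norm_deriv_le (fun r _ => hd x hxΩ r)
    (fun r _ => hder r) (mem_univ t) (mem_univ s)

theorem isLipschitzNonlinearity_of_mem_Lambda {d : ℕ} {Ω : Set (Space d)} (hΩ : MeasurableSet Ω)
    {f : Space d → ℝ → ℝ} {ρ lam : ℝ} (hf : IsAdmissible Ω f ρ)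
    (hfc : ContinuousOn (fun p : Space d × ℝ => f p.1 p.2) (closure Ω ×ˢ Set.univ))
    (hlam : lam ∈ Lambda Ω f ρ) : IsLipschitzNonlinearity Ω f (ρ + 2 / lam) := by
  obtain ⟨F, hF, hFf⟩ := exists_continuous_extension hfc
  refine ⟨hf.memLp_zero, fun y => ?_, fun y => ?_, ?_,
    ae_lipschitz_of_mem_Lambda hΩ hf.differentiable hlam⟩
  · refine (hF.comp_aestronglyMeasurable
      (aestronglyMeasurable_id.prodMk (Lp.aestronglyMeasurable y))).congr ?_
    filter_upwards [ae_restrict_mem hΩ] with x hx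
    simp [hFf x hx]
  · have hP : Continuous fun p : Space d × ℝ => ∫ s in (0 : ℝ)..p.2, F p.1 s :=
      intervalIntegral.continuous_parametric_intervalIntegral_of_continuous
        (f := fun (p : Space d × ℝ) s => F p.1 s)
        (hF.comp (by fun_prop : Continuous fun q : (Space d × ℝ) × ℝ => (q.1.1, q.2)))
        continuous_snd
    refine (hP.comp_aestronglyMeasurable
      (aestronglyMeasurable_id.prodMk (Lp.aestronglyMeasurable y))).congr ?_
    filter_upwards [ae_restrict_mem hΩ] with x hx
    simp [primitive, hFf x hx]
  · have := hlam.1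
    have := hf.rho_pos
    positivity

namespace IsLipschitzNonlinearity

variable {d : ℕ} {Ω : Set (Space d)} {f : Space d → ℝ → ℝ} {L : ℝ}

theorem memLp_comp (h : IsLipschitzNonlinearity Ω f L) (y : L2 Ω) :
    MemLp (fun x => f x (y x)) 2 (volume.restrict Ω) := by
  refine (h.memLp_zero.norm.add ((Lp.memLp y).norm.const_mul L)).of_le
    (h.aestronglyMeasurable y) ?_
  filter_upwards [h.lipschitz] with x hx
  have h1 := hx (y x) 0
  rw [sub_zero] at h1
  have h2 : |f x (y x)| ≤ |f x 0| + |f x (y x) - f x 0| := by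
    simpa using abs_add_le (f x 0) (f x (y x) - f x 0)
  simp only [Pi.add_apply, Real.norm_eq_abs]
  exact (h2.trans (by gcongr)).trans (le_abs_self _)

/-- The superposition operator `y ↦ f(·, y(·))` on `L²(Ω)`. -/
def superposition (h : IsLipschitzNonlinearity Ω f L) (y : L2 Ω) : L2 Ω :=
  (h.memLp_comp y).toLp _

theorem coeFn_superposition (h : IsLipschitzNonlinearity Ω f L) (y : L2 Ω) :
    h.superposition y =ᵐ[volume.restrict Ω] fun x => f x (y x) :=
  (h.memLp_comp y).coeFn_toLp

theorem norm_superposition_sub_le (h : IsLipschitzNonlinearity Ω f L) (y z : L2 Ω) :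
    ‖h.superposition y - h.superposition z‖ ≤ L * ‖y - z‖ := by
  refine Lp.norm_le_mul_norm_of_ae_le_mul ?_
  filter_upwards [h.lipschitz, Lp.coeFn_sub (h.superposition y) (h.superposition z),
    Lp.coeFn_sub y z, h.coeFn_superposition y, h.coeFn_superposition z] with x h1 h2 h3 h4 h5
  rw [h2, h3, Pi.sub_apply, Pi.sub_apply, h4, h5]
  exact h1 _ _

theorem continuous_superposition (h : IsLipschitzNonlinearity Ω f L) :
    Continuous h.superposition :=
  (LipschitzWith.of_dist_le_mul (K := ⟨L, h.nonneg⟩) fun y z => by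
    rw [dist_eq_norm, dist_eq_norm]
    exact h.norm_superposition_sub_le y z).continuous

theorem integrable_primitive (h : IsLipschitzNonlinearity Ω f L) (y : L2 Ω) :
    Integrable (fun x => primitive f x (y x)) (volume.restrict Ω) := by
  have h1 : Integrable (fun x => f x 0 * y x) (volume.restrict Ω) :=
    h.memLp_zero.integrable_mul (Lp.memLp y)
  have h2 : Integrable (fun x => L / 2 * y x ^ 2) (volume.restrict Ω) :=
    (Lp.memLp y).integrable_sq.const_mul _
  have h3 : Integrable (fun x => primitive f x (y x) - f x 0 * y x) (volume.restrict Ω) := by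
    refine h2.mono' ((h.aestronglyMeasurable_primitive y).sub h1.aestronglyMeasurable) ?_
    filter_upwards [h.lipschitz] with x hx
    simpa [primitive] using abs_integral_sub_le_of_lipschitz hx 0 (y x)
  exact (h3.add h1).congr (ae_of_all _ fun x => sub_add_cancel _ _)

theorem abs_integral_primitive_sub_le (h : IsLipschitzNonlinearity Ω f L) (y z : L2 Ω) :
    |(∫ x in Ω, primitive f x (z x)) - (∫ x in Ω, primitive f x (y x)) -
      ⟪h.superposition y, z - y⟫_ℝ| ≤ L / 2 * ‖z - y‖ ^ 2 := by
  have i1 := L2.integrable_inner (𝕜 := ℝ) (h.superposition y) (z - y)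
  have i2 : Integrable (fun x => primitive f x (z x) - primitive f x (y x))
    (volume.restrict Ω) := (h.integrable_primitive z).sub (h.integrable_primitive y)
  rw [L2.inner_def, ← integral_sub (h.integrable_primitive z) (h.integrable_primitive y),
    ← integral_sub i2 i1,
    ← real_inner_self_eq_norm_sq, L2.inner_def, ← integral_const_mul, ← Real.norm_eq_abs]
  refine norm_integral_le_of_norm_le ((L2.integrable_inner (𝕜 := ℝ) _ _).const_mul _) ?_
  filter_upwards [h.lipschitz, Lp.coeFn_sub z y, h.coeFn_superposition y] with x h1 h2 h3
  have := abs_integral_sub_le_of_lipschitz h1 (y x) (z x)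
  rw [h2, h3]
  simpa [primitive, mul_comm, sq] using this

theorem linForm_eq (h : IsLipschitzNonlinearity Ω f L) (lam : ℝ) (y : L2 Ω) (v : H10 Ω) :
    linForm f lam y v = ⟪y + lam • h.superposition y, fn v⟫_ℝ := by
  rw [linForm, L2.inner_def]
  refine integral_congr_ae ?_
  filter_upwards [Lp.coeFn_add y (lam • h.superposition y), Lp.coeFn_smul lam (h.superposition y),
    h.coeFn_superposition y] with x h1 h2 h3
  rw [h1, Pi.add_apply, h2, Pi.smul_apply, h3]
  simp [mul_comm]

theorem energyDeriv_eq (h : IsLipschitzNonlinearity Ω f L) (u v : H10 Ω) :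
    energyDeriv f u v = ⟪grad u, grad v⟫_ℝ - ⟪h.superposition (fn u), fn v⟫_ℝ := by
  rw [energyDeriv, L2.inner_def, L2.inner_def, ← integral_sub (L2.integrable_inner _ _)
    (L2.integrable_inner _ _)]
  refine integral_congr_ae ?_
  filter_upwards [h.coeFn_superposition (fn u)] with x h1
  rw [h1]
  simp [mul_comm]

end IsLipschitzNonlinearity

theorem bilin_eq {d : ℕ} {Ω : Set (Space d)} (lam : ℝ) (u v : H10 Ω) :
    bilin lam u v = lam * ⟪grad u, grad v⟫_ℝ + ⟪fn u, fn v⟫_ℝ := by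
  rw [bilin, L2.inner_def, L2.inner_def, ← integral_const_mul,
    ← integral_add ((L2.integrable_inner _ _).const_mul _) (L2.integrable_inner _ _)]
  simp [mul_comm]

theorem energy_eq {d : ℕ} {Ω : Set (Space d)} (f : Space d → ℝ → ℝ) (v : H10 Ω) :
    energy f v = 1 / 2 * ‖grad v‖ ^ 2 - ∫ x in Ω, primitive f x (fn v x) := by
  rw [energy, ← real_inner_self_eq_norm_sq, L2.inner_def]
  simp

variable {d : ℕ} {Ω : Set (Space d)}

instance completeSpace_H10 : CompleteSpace (H10 Ω) :=
  inferInstanceAs (CompleteSpace (testSubmodule Ω).topologicalClosure)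

/-- The continuous linear map `v ↦ v` from `H¹_0(Ω)` to `L²(Ω)`. -/
def fnL (Ω : Set (Space d)) : H10 Ω →L[ℝ] L2 Ω :=
  (WithLp.fstL 2 ℝ (L2 Ω) (L2Vec Ω)).comp (H10 Ω).subtypeL

/-- The continuous linear map `v ↦ ∇v` from `H¹_0(Ω)` to `L²(Ω; ℝ^d)`. -/
def gradL (Ω : Set (Space d)) : H10 Ω →L[ℝ] L2Vec Ω :=
  (WithLp.sndL 2 ℝ (L2 Ω) (L2Vec Ω)).comp (H10 Ω).subtypeL

theorem fnL_apply (v : H10 Ω) : fnL Ω v = fn v := rfl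

theorem norm_sq_eq_H10 (v : H10 Ω) : ‖v‖ ^ 2 = ‖fn v‖ ^ 2 + ‖grad v‖ ^ 2 :=
  WithLp.prod_norm_sq_eq_of_L2 (v : Pairs Ω)

/-- The form `bilin` as a continuous bilinear form. -/
def bilinL (Ω : Set (Space d)) (lam : ℝ) : H10 Ω →L[ℝ] H10 Ω →L[ℝ] ℝ :=
  lam • (innerSL ℝ).bilinearComp (gradL Ω) (gradL Ω) +
    (innerSL ℝ).bilinearComp (fnL Ω) (fnL Ω)

theorem bilinL_apply (lam : ℝ) (u v : H10 Ω) : bilinL Ω lam u v = bilin lam u v := by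
  rw [bilin_eq]; rfl

theorem isCoercive_bilinL {lam : ℝ} (hlam : 0 < lam) : IsCoercive (bilinL Ω lam) := by
  refine ⟨min lam 1, by positivity, fun u => ?_⟩
  rw [bilinL_apply, bilin_eq, real_inner_self_eq_norm_sq, real_inner_self_eq_norm_sq,
    mul_assoc, ← sq, norm_sq_eq_H10]
  nlinarith [min_le_left lam 1, min_le_right lam 1, sq_nonneg ‖fn u‖, sq_nonneg ‖grad u‖]

/-- The solution operator `g ↦ u` of the problem `B_λ(u, v) = ∫_Ω g v` for all `v ∈ V`. -/
theorem exists_solution_operator (Ω : Set (Space d)) {lam : ℝ} (hlam : 0 < lam) :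
    ∃ S : L2 Ω →L[ℝ] H10 Ω, ∀ (g : L2 Ω) (u : H10 Ω),
      (∀ v, bilin lam u v = ⟪g, fn v⟫_ℝ) ↔ u = S g := by
  have hc := isCoercive_bilinL (Ω := Ω) hlam
  refine ⟨(hc.continuousLinearEquivOfBilin.symm : H10 Ω →L[ℝ] H10 Ω).comp
    (ContinuousLinearMap.adjoint (fnL Ω)), fun g u => ?_⟩
  have e : ∀ v, (bilin lam u v = ⟪g, fn v⟫_ℝ) ↔
      ⟪hc.continuousLinearEquivOfBilin u, v⟫_ℝ = ⟪ContinuousLinearMap.adjoint (fnL Ω) g, v⟫_ℝ := by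
    intro v
    rw [hc.continuousLinearEquivOfBilin_apply, bilinL_apply,
      ContinuousLinearMap.adjoint_inner_left, fnL_apply]
  simp only [e, ContinuousLinearMap.comp_apply, ContinuousLinearEquiv.coe_coe,
    ContinuousLinearEquiv.eq_symm_apply]
  exact ⟨fun h => ext_inner_right ℝ h, fun h v => by rw [h]⟩

theorem fn_sq_le_of_poincareConst_pos (h : 0 < poincareConst Ω) (v : H10 Ω) :
    ‖fn v‖ ^ 2 ≤ poincareConst Ω * ‖grad v‖ ^ 2 := by
  have hne : {C : ℝ | 0 < C ∧ ∀ v : H10 Ω, ‖fn v‖ ^ 2 ≤ C * ‖grad v‖ ^ 2}.Nonempty := by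
    by_contra hne
    rw [not_nonempty_iff_eq_empty] at hne
    rw [poincareConst, hne, Real.sInf_empty] at h
    exact lt_irrefl _ h
  rw [mul_comm, ← smul_eq_mul, poincareConst, ← Real.sInf_smul_of_nonneg (sq_nonneg _)]
  refine le_csInf (hne.smul_set) ?_
  rintro _ ⟨C, hC, rfl⟩
  simpa [mul_comm] using hC.2 v

theorem fn_sq_div_le (v : H10 Ω) :
    1 / (2 * poincareConst Ω) * ‖fn v‖ ^ 2 ≤ 1 / 2 * ‖grad v‖ ^ 2 := by
  have h0 : 0 ≤ poincareConst Ω := Real.sInf_nonneg fun C hC => hC.1.le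
  rcases h0.eq_or_lt with h | h
  · rw [← h]; simp
  · have := fn_sq_le_of_poincareConst_pos h v
    rw [div_mul_eq_mul_div, div_le_iff₀ (by positivity)]
    linarith

theorem exists_mem_Lambda_inv_lt {f : Space d → ℝ → ℝ} {ρ : ℝ} (hne : (Lambda Ω f ρ).Nonempty)
    {c : ℝ} (hc : mu Ω f ρ < c) : ∃ lam ∈ Lambda Ω f ρ, 1 / lam < c := by
  by_cases hb : BddAbove (Lambda Ω f ρ)
  · rw [mu, if_pos hb] at hc
    obtain ⟨l₀, hl₀⟩ := hne
    have hpos : 0 < sSup (Lambda Ω f ρ) := hl₀.1.trans_le (le_csSup hb hl₀)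
    have hc0 : 0 < c := (inv_pos.2 hpos).trans hc
    obtain ⟨l, hl, hlt⟩ := exists_lt_of_lt_csSup ⟨l₀, hl₀⟩ ((inv_lt_comm₀ hpos hc0).1 hc)
    exact ⟨l, hl, by rw [one_div]; exact (inv_lt_comm₀ hc0 hl.1).1 hlt⟩
  · rw [mu, if_neg hb] at hc
    obtain ⟨l, hl, hlt⟩ := not_bddAbove_iff.1 hb c⁻¹
    exact ⟨l, hl, by rw [one_div]; exact (inv_lt_comm₀ hc hl.1).1 hlt⟩

/-- The energy decreases along a step of the iteration. -/
theorem energy_step_le {f : Space d → ℝ → ℝ} {L : ℝ} (h : IsLipschitzNonlinearity Ω f L)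
    {dt : ℝ} (hdt : 0 < dt) {u w : H10 Ω}
    (hw : ∀ v, bilin dt w v = linForm f dt (fn u) v) :
    energy f w + (1 / dt - (L / 2 - 1 / (2 * poincareConst Ω))) * ‖fn w - fn u‖ ^ 2 ≤
      energy f u := by
  have h1 := hw (w - u)
  rw [h.linForm_eq, bilin_eq] at h1
  have e1 : fn (w - u) = fn w - fn u := rfl
  have e2 : grad (w - u) = grad w - grad u := rfl
  rw [inner_add_left, real_inner_smul_left, e1, e2] at h1
  have h2 := (abs_le.1 (h.abs_integral_primitive_sub_le (fn u) (fn w))).1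
  have h3 := fn_sq_div_le (w - u)
  rw [e1, e2] at h3
  have h4 : ‖grad w - grad u‖ ^ 2 = 2 * ⟪grad w, grad w - grad u⟫_ℝ - ‖grad w‖ ^ 2
      + ‖grad u‖ ^ 2 := by
    rw [norm_sub_sq_real, inner_sub_right, real_inner_self_eq_norm_sq]
    ring
  have h5 : ‖fn w - fn u‖ ^ 2 = ⟪fn w, fn w - fn u⟫_ℝ - ⟪fn u, fn w - fn u⟫_ℝ := by
    rw [← inner_sub_left, real_inner_self_eq_norm_sq]
  have h6 : ⟪grad w, grad w - grad u⟫_ℝ - ⟪h.superposition (fn u), fn w - fn u⟫_ℝ =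
      -(1 / dt * ‖fn w - fn u‖ ^ 2) := by
    rw [h5]
    field_simp
    linarith
  rw [energy_eq, energy_eq]
  linarith

theorem exists_norm_le_of_energy_le {f : Space d → ℝ → ℝ} (hE : IsWeaklyCoercive Ω f) (c : ℝ) :
    ∃ R : ℝ, ∀ v : H10 Ω, energy f v ≤ c → ‖v‖ ≤ R := by
  obtain ⟨lam, hlam, ht⟩ := hE
  have := ht.eventually_gt_atTop c
  rw [eventually_comap] at this
  obtain ⟨M, hM⟩ := eventually_atTop.1 this
  refine ⟨Real.sqrt (M ^ 2 / min lam 1), fun v hv => Real.le_sqrt_of_sq_le ?_⟩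
  have h1 : lamNorm lam v < M := by
    by_contra! hcon
    exact (hM _ hcon v rfl).not_ge hv
  have h2 : lam * ‖grad v‖ ^ 2 + ‖fn v‖ ^ 2 ≤ M ^ 2 := by
    rw [← Real.sq_sqrt (by positivity : 0 ≤ lam * ‖grad v‖ ^ 2 + ‖fn v‖ ^ 2)]
    exact pow_le_pow_left₀ (Real.sqrt_nonneg _) h1.le 2
  rw [le_div_iff₀ (by positivity), norm_sq_eq_H10]
  nlinarith [min_le_left lam 1, min_le_right lam 1, sq_nonneg ‖fn v‖, sq_nonneg ‖grad v‖]

theorem neg_le_energy {f : Space d → ℝ → ℝ} {L : ℝ} (h : IsLipschitzNonlinearity Ω f L)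
    (v : H10 Ω) :
    -(‖h.superposition 0‖ * ‖v‖ + L / 2 * ‖v‖ ^ 2) ≤ energy f v := by
  have h1 := (abs_le.1 (h.abs_integral_primitive_sub_le 0 (fn v))).2
  have h0 : ∫ x in Ω, primitive f x ((0 : L2 Ω) x) = 0 := by
    refine integral_eq_zero_of_ae ?_
    filter_upwards [Lp.coeFn_zero ℝ 2 (volume.restrict Ω)] with x hx
    have hx0 : (0 : L2 Ω) x = 0 := hx
    rw [primitive, hx0]
    simp
  rw [h0, sub_zero, sub_zero] at h1
  have h2 := real_inner_le_norm (h.superposition 0) (fn v)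
  have h3 : ‖fn v‖ ≤ ‖v‖ := WithLp.norm_fst_le _ _
  have h4 : ‖h.superposition 0‖ * ‖fn v‖ ≤ ‖h.superposition 0‖ * ‖v‖ := by gcongr
  have h5 : L / 2 * ‖fn v‖ ^ 2 ≤ L / 2 * ‖v‖ ^ 2 := by
    have := h.nonneg
    gcongr
  rw [energy_eq]
  nlinarith [sq_nonneg ‖grad v‖]

theorem tendsto_zero_of_add_le {a b : ℕ → ℝ} {δ m : ℝ} (hδ : 0 < δ) (hb : ∀ n, 0 ≤ b n)
    (hab : ∀ n, a (n + 1) + δ * b n ≤ a n) (hm : ∀ n, m ≤ a n) :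
    Tendsto b atTop (𝓝 0) := by
  have hanti : Antitone a := antitone_nat_of_succ_le fun n => by
    have := hab n
    have := mul_nonneg hδ.le (hb n)
    linarith
  have hlim := tendsto_atTop_ciInf hanti ⟨m, by rintro _ ⟨n, rfl⟩; exact hm n⟩
  have hdiff := (hlim.sub (hlim.comp (tendsto_add_atTop_nat 1))).div_const δ
  rw [sub_self, zero_div] at hdiff
  refine squeeze_zero hb (fun n => ?_) hdiff
  rw [le_div_iff₀ hδ]
  have := hab n
  simp only [Function.comp]
  linarith

theorem existsUnique_isIteration {f : Space d → ℝ → ℝ} {L : ℝ}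
    (h : IsLipschitzNonlinearity Ω f L) {dt : ℝ} (hdt : 0 < dt) (u₀ : L2 Ω) :
    ∃! u : ℕ → H10 Ω, IsIteration f dt u₀ u := by
  obtain ⟨S, hS⟩ := exists_solution_operator Ω hdt
  let T : L2 Ω → H10 Ω := fun y => S (y + dt • h.superposition y)
  have key : ∀ u : ℕ → H10 Ω, IsIteration f dt u₀ u ↔
      u 0 = T u₀ ∧ ∀ n, u (n + 1) = T (fn (u n)) := fun u => by
    simp only [IsIteration, h.linForm_eq, hS]
    rfl
  refine ⟨fun n => Nat.rec (T u₀) (fun _ v => T (fn v)) n, (key _).2 ⟨rfl, fun n => rfl⟩, ?_⟩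
  intro u hu
  obtain ⟨hu0, hus⟩ := (key u).1 hu
  funext n
  induction n with
  | zero => exact hu0
  | succ n ih => rw [hus, ih]

theorem exists_subseq_tendsto_weakSolution (hΩ : IsOpen Ω) (hΩb : Bornology.IsBounded Ω)
    {f : Space d → ℝ → ℝ} {L : ℝ} (h : IsLipschitzNonlinearity Ω f L)
    (hE : IsWeaklyCoercive Ω f) {dt : ℝ} (hdt : 0 < dt)
    (hL : L / 2 - 1 / (2 * poincareConst Ω) < 1 / dt) {u : ℕ → H10 Ω}
    (hu : ∀ n v, bilin dt (u (n + 1)) v = linForm f dt (fn (u n)) v) :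
    ∃ ustar : H10 Ω, IsWeakSolution f ustar ∧
      ∃ φ : ℕ → ℕ, StrictMono φ ∧ Tendsto (fun k => u (φ k)) atTop (𝓝 ustar) := by
  have hδ : 0 < 1 / dt - (L / 2 - 1 / (2 * poincareConst Ω)) := sub_pos.2 hL
  have hdec := fun n => energy_step_le h hdt (hu n)
  have hanti : Antitone fun n => energy f (u n) := antitone_nat_of_succ_le fun n => by
    have := hdec n
    have := mul_nonneg hδ.le (sq_nonneg ‖fn (u (n + 1)) - fn (u n)‖)
    linarith
  obtain ⟨R, hR⟩ := exists_norm_le_of_energy_le hE (energy f (u 0))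
  have hRu : ∀ n, ‖u n‖ ≤ R := fun n => hR _ (hanti (Nat.zero_le n))
  have hLn := h.nonneg
  have hsq := tendsto_zero_of_add_le (m := -(‖h.superposition 0‖ * R + L / 2 * R ^ 2)) hδ
    (fun n => sq_nonneg ‖fn (u (n + 1)) - fn (u n)‖) hdec fun n => by
      refine le_trans (neg_le_neg ?_) (neg_le_energy h (u n))
      have := hRu n
      gcongr
  have hw : Tendsto (fun n => fn (u (n + 1)) - fn (u n)) atTop (𝓝 0) := by
    rw [tendsto_zero_iff_norm_tendsto_zero]
    simpa using hsq.sqrt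
  obtain ⟨y, φ, hφ, hy⟩ := exists_subseq_tendsto_fn hΩ hΩb hRu
  obtain ⟨S, hS⟩ := exists_solution_operator Ω hdt
  have hT : Continuous fun y : L2 Ω => S (y + dt • h.superposition y) :=
    S.continuous.comp (continuous_id.add (h.continuous_superposition.const_smul dt))
  have hstep : ∀ n, u (n + 1) = S (fn (u n) + dt • h.superposition (fn (u n))) := fun n =>
    (hS _ _).1 fun v => by rw [hu, h.linForm_eq]
  set ustar := S (y + dt • h.superposition y) with hus
  have hlim : Tendsto (fun k => u (φ k + 1)) atTop (𝓝 ustar) := by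
    simp only [hstep]
    exact (hT.tendsto y).comp hy
  have hfn : fn ustar = y := by
    have h1 : Tendsto (fun k => fn (u (φ k + 1))) atTop (𝓝 (fn ustar)) :=
      ((fnL Ω).continuous.tendsto ustar).comp hlim
    have h2 := (hw.comp hφ.tendsto_atTop).add hy
    simp only [Function.comp, sub_add_cancel, zero_add] at h2
    exact tendsto_nhds_unique h1 h2
  refine ⟨ustar, fun v => ?_, fun k => φ k + 1, fun a b hab => Nat.succ_lt_succ (hφ hab), hlim⟩
  have h1 := (hS _ ustar).2 hus v
  rw [bilin_eq, inner_add_left, real_inner_smul_left, hfn] at h1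
  rw [h.energyDeriv_eq, hfn]
  have h2 : dt * (⟪grad ustar, grad v⟫_ℝ - ⟪h.superposition y, fn v⟫_ℝ) = 0 := by linarith
  exact (mul_eq_zero.1 h2).resolve_left hdt.ne'

end Semilinear

end

theorem mainTheorem5 {d : ℕ} (hd : 1 ≤ d) (Ω : Set (Semilinear.Space d))
    (hΩ : IsOpen Ω) (hΩn : Ω.Nonempty) (hΩb : Bornology.IsBounded Ω)
    (f : Semilinear.Space d → ℝ → ℝ) (ρ : ℝ)
    (hf : Semilinear.IsAdmissible Ω f ρ)
    (hfc : ContinuousOn (fun p : Semilinear.Space d × ℝ => f p.1 p.2) (closure Ω ×ˢ Set.univ))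
    (hE : Semilinear.IsWeaklyCoercive Ω f)
    (dt : ℝ) (hdt : 0 < dt) (hdtκ : Semilinear.kappa Ω f ρ < 1 / dt)
    (u₀ : Semilinear.L2 Ω) :
    (∃! u : ℕ → Semilinear.H10 Ω, Semilinear.IsIteration f dt u₀ u) ∧
      ∀ u : ℕ → Semilinear.H10 Ω, Semilinear.IsIteration f dt u₀ u →
        ∃ ustar : Semilinear.H10 Ω, Semilinear.IsWeakSolution f ustar ∧
          ∃ φ : ℕ → ℕ, StrictMono φ ∧
            Filter.Tendsto (fun k => u (φ k)) Filter.atTop (nhds ustar) := by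
  have hκ := (le_max_left _ _).trans_lt hdtκ
  obtain ⟨lam, hlam, hlt⟩ := Semilinear.exists_mem_Lambda_inv_lt hf.nonempty
    (c := 1 / dt - ρ / 2 + 1 / (2 * Semilinear.poincareConst Ω)) (by linarith)
  have h := Semilinear.isLipschitzNonlinearity_of_mem_Lambda hΩ.measurableSet hf hfc hlam
  refine ⟨Semilinear.existsUnique_isIteration h hdt u₀, fun u hu =>
    Semilinear.exists_subseq_tendsto_weakSolution hΩ hΩb h hE hdt ?_ hu.2⟩
  have e : (ρ + 2 / lam) / 2 = ρ / 2 + 1 / lam := by ring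
  linarith
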